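/- Let $\mathcal{X}\subset\mathbb{R}$ be a bounded interval with the Euclidean distance $d$, let $f:\mathcal{X}\to\mathcal{X}$ be measurable, and let $\mu$ be an $f$-invariant ergodic probability measure on $\mathcal{X}$ that is absolutely continuous with density $\rho\ge 0$ with respect to Lebesgue measure. For $\varphi:\mathcal{X}\to\mathbb{R}$ put $\|\varphi\|_{\mathrm{BV}}=\mathrm{var}(\varphi)+\sup|\varphi|$, and let $\mathrm{BV}$ be the set of $\varphi$ with $\|\varphi\|_{\mathrm{BV}}<\infty$. Assume that $(\mathcal{X},f,\mu)$ is hyperbolic recurrent, that is, $\rho\in\mathrm{BV}$ and: (A1) (exponential decay of correlations of $\mathrm{BV}$ versus $L^1(\mu)$) there are $C,\alpha>0$ such that for all $\varphi_1\in \mathrm{BV}$, $\varphi_2\in L^1(\mu)$ and $j\ge 0$, $$\Bigl|\int\varphi_1\cdot\varphi_2\circ f^j\,d\mu-\int\varphi_1\,d\mu\int\varphi_2\,d\mu\Bigr|\le Ce^{-\alpha j}\,\|\varphi_1\|_{\mathrm{BV}}\int|\varphi_2|\,d\mu ;$$ (A2) for every $a>0$ and every sequence $(s_n)$ for which there is $c>1$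 with $s_n/n^{-a}\in[c^{-1},c]$ for all large $n$, there are $\beta_0\in(0,1)$ and $C>0$ such that for all large $n$ and all integers $1\le j\le(\log n)^2$, $$\mu\{x\in\mathcal{X}: d(x,f^jx)\le s_n\}\le C s_n^{\beta_0}.$$ Suppose that $\rho$ is piecewise Hölder with finitely many jumps: the set $\mathcal{C}$ of discontinuity points of $\rho$ in $\mathcal{X}$ is finite, and there are $\eta\in(0,1]$, $L>0$ and $\delta>0$ such that $|\rho(x)-\rho(y)|\le L|x-y|^\eta$ for all $x,y\in\mathcal{X}$ with $|x-y|<\delta$ for which the closed interval between $x$ and $y$ contains no point of $\mathcal{C}$. (In particular $\rho$ has left and right limits at the points of $\mathcal{C}$.) Let $\gamma_0\in\mathbb{R}$ be such that $$\sum_{k\ge 1}\int_{\mathcal{X}}\rho(x)e^{-\epsilon k^{\gamma_0}\rho(x)}\,dx<\infty\qquad\text{for all }\epsilon>0,$$ let $\gamma>\gamma_0$, and let $(r_n)$ be a real sequence with $r_n>\frac{(\log n)^{\gamma}}{2n}$ for all sufficiently large $n$. Then $$\mu\Bigl\{x\in\mathcal{X}:\ \min_{1\le k\le n}d(f^kx,x)<r_n\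 \text{ for all sufficiently large } n\Bigr\}=1.$$ -/

import Mathlib

open MeasureTheory Filter Topology Set
open scoped ENNReal

/-- The phase space is a subset `X` of the line with its ambient metric, its order and Lebesgue
measure, so all notions below are for functions and maps on the type `X`.
`bvNorm φ = var(φ) + sup |φ|`, with values in `[0, ∞]`. -/
noncomputable def bvNorm {X : Set ℝ} (φ : X → ℝ) : ℝ≥0∞ :=
  eVariationOn φ univ + ⨆ x, ‖φ x‖ₑ

/-- Functions of bounded variation: `‖φ‖_BV < ∞`. -/
def IsBV {X : Set ℝ} (φ : X → ℝ) : Prop := bvNorm φ < ∞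

/-- Decay of correlations in `BV` versus `L¹(μ)` with rate function `Θ(j) → 0`. -/
def HasDecayBVL1 {X : Set ℝ} (f : X → X) (μ : Measure X) (Θ : ℕ → ℝ) : Prop :=
  Tendsto Θ atTop (𝓝 0) ∧
  ∀ φ₁ φ₂ : X → ℝ, IsBV φ₁ → Integrable φ₂ μ → ∀ j : ℕ,
    |∫ x, φ₁ x * φ₂ (f^[j] x) ∂μ - (∫ x, φ₁ x ∂μ) * ∫ x, φ₂ x ∂μ|
      ≤ Θ j * (bvNorm φ₁).toReal * ∫ x, |φ₂ x| ∂μ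

/-- Exponential decay of correlations in `BV` versus `L¹(μ)`. -/
def HasExpDecayBVL1 {X : Set ℝ} (f : X → X) (μ : Measure X) : Prop :=
  ∃ C α : ℝ, 0 < C ∧ 0 < α ∧ HasDecayBVL1 f μ (fun j => C * Real.exp (-α * j))

/-- The set `E_j(r)` of points that return to within distance `r` of themselves at time `j`. -/
def returnSet {X : Set ℝ} (f : X → X) (j : ℕ) (r : ℝ) : Set X :=
  {x | dist x (f^[j] x) ≤ r}

/-- `a_n ≈ b_n`: the ratio stays in `[c⁻¹, c]` for all large `n`. -/
def Comparable (a b : ℕ → ℝ) : Prop :=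
  ∃ c : ℝ, 1 < c ∧ ∀ᶠ n in atTop, a n / b n ∈ Icc c⁻¹ c

/-- Short returns are rare: if `r_n ≈ n^{-a}` for some `a > 0`, then `μ(E_j(r_n)) ≤ C r_n^{β₀}` for
all `1 ≤ j ≤ (log n)²`, with `β₀ ∈ (0, 1)` and `C` independent of `j` and `n`. -/
def HasRareShortReturns {X : Set ℝ} (f : X → X) (μ : Measure X) : Prop :=
  ∀ (a : ℝ) (r : ℕ → ℝ), 0 < a → Comparable r (fun n => (n : ℝ) ^ (-a)) →
    ∃ β₀ C : ℝ, 0 < β₀ ∧ β₀ < 1 ∧ 0 < C ∧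
      ∀ᶠ n : ℕ in atTop, ∀ j : ℕ, 1 ≤ j → (j : ℝ) ≤ Real.log n ^ 2 →
        μ.real (returnSet f j (r n)) ≤ C * r n ^ β₀

/-- Lebesgue measure on `X`. -/
noncomputable def lebesgueOn (X : Set ℝ) : Measure X := Measure.comap Subtype.val volume

/-- A hyperbolic recurrent system `(X, f, μ)` with invariant density `ρ ∈ BV`. `Ergodic` contains
the measurability of `f` and the invariance of `μ`. -/
structure IsHyperbolicRecurrent {X : Set ℝ} (f : X → X) (μ : Measure X) (ρ : X → ℝ) : Prop where
  ergodic : Ergodic f μ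
  density_nonneg : ∀ x, 0 ≤ ρ x
  density_eq : μ = (lebesgueOn X).withDensity (fun x => ENNReal.ofReal (ρ x))
  density_bv : IsBV ρ
  exp_decay : HasExpDecayBVL1 f μ
  rare_short_returns : HasRareShortReturns f μ

/-- The points of `X` at which `ρ` is discontinuous (relative to `X`). -/
def discontinuities {X : Set ℝ} (ρ : X → ℝ) : Set X := {x | ¬ ContinuousAt ρ x}

/-- `ρ` has finitely many discontinuities and is uniformly Hölder on every piece of `X` between
consecutive ones, with the same exponent and constants on all pieces. At the discontinuities the
one-sided limits exist because of the Hölder bound, and the value of `ρ` there is not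
constrained. -/
def IsPiecewiseHolder {X : Set ℝ} (ρ : X → ℝ) : Prop :=
  (discontinuities ρ).Finite ∧
  ∃ η L δ : ℝ, 0 < η ∧ η ≤ 1 ∧ 0 < L ∧ 0 < δ ∧
    ∀ x y : X, dist x y < δ → Disjoint (uIcc x y) (discontinuities ρ) →
      |ρ x - ρ y| ≤ L * dist x y ^ η

/-- `min_{1 ≤ k ≤ n} d(f^k x, x)`, for `n ≥ 1`. -/
noncomputable def minReturnDist {X : Set ℝ} (f : X → X) (n : ℕ) (x : X) : ℝ :=
  sInf ((fun k : ℕ => dist (f^[k] x) x) '' Icc 1 n)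

/-! At times of order `2 ^ k` use the scale `s = c k^γ 2^(-k)` and cut `X` into cells of length `s`.
A point whose orbit stays at distance at least `s` from it never returns to its own cell `A`, so the
task is to bound the part of each cell that does not return.

Decay of correlations makes `A` nearly independent of the future after a gap `g` of order `k`. The
probability `T n` of avoiding `A` for `n` steps then satisfies `T (n + 1) ≤ T n * (1 - μ(A) + e) +
Q`, where `e` is the decorrelation error and `Q` measures the returns to `A` within the gap. Hence
the non-returning part of `A` has measure at most a constant times `μ(A) exp(-n μ(A))`, up to errors
(`measureReal_inter_preimage_avoidSet_le`). On a full cell without jumps of `ρ` the Hölder bound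
gives `μ(A) ≈ s ρ`, and summation over cells yields a multiple of `∫ ρ exp(-n s ρ)`
(`measureReal_noReturnSet_le`).

For `n = 2 ^ k` one has `n s = c k^γ`, which eventually exceeds `k^γ₀`, so this main term is
summable in `k` by hypothesis. The errors are geometric up to powers of `k`: short returns by (A2),
decorrelation by (A1), and cells near jumps or end points because there are boundedly many.
Borel–Cantelli along dyadic times, with `dyadic_scale_le` for the times in between, concludes. -/

/-- The points whose orbit avoids `A` at the times `0, …, n - 1`. -/
def avoidSet {α : Type*} (f : α → α) (A : Set α) (n : ℕ) : Set α := {x | ∀ j < n, f^[j] x ∉ A}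

/-! ### Avoidance probabilities for a single set -/

section Avoid

variable {α : Type*}

theorem avoidSet_succ (f : α → α) (A : Set α) (n : ℕ) :
    avoidSet f A (n + 1) = f ⁻¹' avoidSet f A n \ A := by
  ext x
  simp only [avoidSet, mem_ofPred_eq, Set.mem_sdiff, mem_preimage]
  constructor
  · intro h
    exact ⟨fun j hj => h (j + 1) (by omega), h 0 (by omega)⟩
  · rintro ⟨h1, h0⟩ j hj
    cases j with
    | zero => exact h0
    | succ j => exact h1 j (by omega)

theorem inter_preimage_avoidSet_subset (f : α → α) (A : Set α) (g n : ℕ) :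
    A ∩ f ⁻¹' avoidSet f A (g + n) ⊆ A ∩ f^[g + 1] ⁻¹' avoidSet f A n := by
  rintro x ⟨hx, h⟩
  refine ⟨hx, fun j hj => ?_⟩
  have := h (g + j) (by omega)
  rwa [← Function.iterate_succ_apply, show (g + j).succ = j + (g + 1) by omega,
    Function.iterate_add_apply] at this

/-- Opening a gap in the avoidance window costs only the points of `A` that return during the gap.
-/
theorem inter_iterate_preimage_avoidSet_subset (f : α → α) (A : Set α) (g n : ℕ) :
    A ∩ f^[g + 1] ⁻¹' avoidSet f A n ⊆
      (A ∩ f ⁻¹' avoidSet f A n) ∪ ⋃ j ∈ Finset.Icc 1 g, A ∩ f^[j] ⁻¹' A := by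
  rintro x ⟨hx, h⟩
  by_cases hs : ∃ j ∈ Finset.Icc 1 g, f^[j] x ∈ A
  · obtain ⟨j, hj, hj'⟩ := hs
    exact Or.inr (mem_biUnion hj ⟨hx, hj'⟩)
  · refine Or.inl ⟨hx, fun j hj hj' => ?_⟩
    rw [← Function.iterate_succ_apply] at hj'
    by_cases hjg : j + 1 ≤ g
    · exact hs ⟨j + 1, Finset.mem_Icc.2 ⟨by omega, hjg⟩, hj'⟩
    · refine h (j - g) (by omega) ?_
      rwa [← Function.iterate_add_apply, show j - g + (g + 1) = j.succ by omega]

variable [MeasurableSpace α] {f : α → α} {A : Set α}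

theorem measurableSet_avoidSet (hf : Measurable f) (hA : MeasurableSet A) (n : ℕ) :
    MeasurableSet (avoidSet f A n) := by
  have : avoidSet f A n = ⋂ j, ⋂ _ : j < n, (f^[j] ⁻¹' A)ᶜ := by
    ext x; simp [avoidSet]
  rw [this]
  exact MeasurableSet.iInter fun j => MeasurableSet.iInter fun _ => ((hf.iterate j) hA).compl

variable {μ : Measure α} [IsProbabilityMeasure μ]

/-- An exponential bound for the hitting time of `A`, up to the measure of the short returns. -/
theorem measureReal_avoidSet_le (hf : MeasurePreserving f μ μ) (hA : MeasurableSet A)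
    {e : ℝ} (he : 0 ≤ e) (g : ℕ)
    (hdec : ∀ n, |μ.real (A ∩ f^[g + 1] ⁻¹' avoidSet f A n)
      - μ.real A * μ.real (avoidSet f A n)| ≤ e * μ.real (avoidSet f A n)) (n : ℕ) :
    μ.real (avoidSet f A n) ≤ Real.exp (n * e) * (Real.exp (-(n * μ.real A))
      + n * ∑ j ∈ Finset.Icc 1 g, μ.real (A ∩ f^[j] ⁻¹' A)) := by
  set Q := ∑ j ∈ Finset.Icc 1 g, μ.real (A ∩ f^[j] ⁻¹' A) with hQ
  have hQ0 : 0 ≤ Q := Finset.sum_nonneg fun _ _ => measureReal_nonneg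
  induction n with
  | zero => simp
  | succ n ih =>
    set T := μ.real (avoidSet f A n)
    have hD := measurableSet_avoidSet hf.measurable hA n
    have h1 : μ.real (avoidSet f A (n + 1)) = T - μ.real (A ∩ f ⁻¹' avoidSet f A n) := by
      have h := measureReal_sdiff_add_inter (μ := μ) (s := f ⁻¹' avoidSet f A n) hA
      rw [hf.measureReal_preimage hD.nullMeasurableSet, ← avoidSet_succ, inter_comm] at h
      linarith
    have h2 : μ.real (A ∩ f^[g + 1] ⁻¹' avoidSet f A n)
        ≤ μ.real (A ∩ f ⁻¹' avoidSet f A n) + Q :=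
      (measureReal_mono (inter_iterate_preimage_avoidSet_subset f A g n)).trans <|
        (measureReal_union_le _ _).trans <|
          add_le_add_right (measureReal_biUnion_finset_le _ _) _
    have h3 := (abs_le.1 (hdec n)).1
    have hT : 0 ≤ T := measureReal_nonneg
    -- One step of the recursion, with `1 + x ≤ exp x` turning the factor `1 - μ(A) + e` into an
    -- exponential.
    have h4 : μ.real (avoidSet f A (n + 1)) ≤ T * Real.exp (e - μ.real A) + Q := by
      have : T * (e - μ.real A + 1) ≤ T * Real.exp (e - μ.real A) :=
        mul_le_mul_of_nonneg_left (Real.add_one_le_exp _) hT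
      rw [h1]; linarith
    have h5 : T * Real.exp (e - μ.real A) ≤
        Real.exp (n * e) * (Real.exp (-(n * μ.real A)) + n * Q) * Real.exp (e - μ.real A) :=
      mul_le_mul_of_nonneg_right ih (Real.exp_pos _).le
    have h6 : Real.exp (n * e) * Real.exp (-(n * μ.real A)) * Real.exp (e - μ.real A)
        = Real.exp ((n + 1) * e) * Real.exp (-((n + 1) * μ.real A)) := by
      rw [← Real.exp_add, ← Real.exp_add, ← Real.exp_add]; congr 1; ring
    have h7 : Real.exp (n * e) * Real.exp (e - μ.real A) ≤ Real.exp ((n + 1) * e) := by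
      rw [← Real.exp_add]
      apply Real.exp_le_exp.2
      have : 0 ≤ μ.real A := measureReal_nonneg
      linarith
    have h8 : 1 ≤ Real.exp ((n + 1) * e) := Real.one_le_exp (by positivity)
    have h9 := mul_le_mul_of_nonneg_right h7 (mul_nonneg n.cast_nonneg hQ0)
    have h10 := mul_le_mul_of_nonneg_right h8 hQ0
    push_cast
    linarith

/-- A bound for the measure of the points of `A` that do not return to `A` before time
`g + n + 1`. -/
theorem measureReal_inter_preimage_avoidSet_le (hf : MeasurePreserving f μ μ)
    (hA : MeasurableSet A) {e : ℝ} (he : 0 ≤ e) (g : ℕ)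
    (hdec : ∀ n, |μ.real (A ∩ f^[g + 1] ⁻¹' avoidSet f A n)
      - μ.real A * μ.real (avoidSet f A n)| ≤ e * μ.real (avoidSet f A n)) (n : ℕ)
    (hne : n * e ≤ 1) :
    μ.real (A ∩ f ⁻¹' avoidSet f A (g + n)) ≤ 3 * (μ.real A * Real.exp (-(n * μ.real A)))
      + 3 * μ.real A * n * ∑ j ∈ Finset.Icc 1 g, μ.real (A ∩ f^[j] ⁻¹' A) + e := by
  have h1 := measureReal_mono (μ := μ) (inter_preimage_avoidSet_subset f A g n)
  have h2 := (abs_le.1 (hdec n)).2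
  have h3 := measureReal_avoidSet_le hf hA he g hdec n
  set Q := ∑ j ∈ Finset.Icc 1 g, μ.real (A ∩ f^[j] ⁻¹' A) with hQ
  have hQ0 : 0 ≤ Q := Finset.sum_nonneg fun _ _ => measureReal_nonneg
  have h4 : Real.exp (n * e) ≤ 3 :=
    (Real.exp_le_exp.2 hne).trans (Real.exp_one_lt_d9.le.trans (by norm_num))
  have h5 : μ.real (avoidSet f A n) ≤ 3 * (Real.exp (-(n * μ.real A)) + n * Q) :=
    h3.trans (mul_le_mul_of_nonneg_right h4 (by positivity))
  have h6 := mul_le_mul_of_nonneg_left h5 (measureReal_nonneg (μ := μ) (s := A))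
  have h7 : e * μ.real (avoidSet f A n) ≤ e * 1 :=
    mul_le_mul_of_nonneg_left measureReal_le_one he
  linarith

end Avoid

/-! ### Grid cells, BV observables and the density -/

section Line

variable {X : Set ℝ}

/-- On each bounded piece the variation of a monotone function is its increment, at most 1. The
supremum over pieces is needed since `X` may lack end points. -/
theorem bvNorm_le_two_of_monotone {h : X → ℝ} (hm : Monotone h) (h0 : ∀ x, 0 ≤ h x)
    (h1 : ∀ x, h x ≤ 1) : bvNorm h ≤ 2 := by
  have hv : eVariationOn h univ ≤ 1 := by
    rw [eVariationOn.eq_biSup_inter_Icc]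
    refine iSup₂_le fun p _ => ?_
    rw [(hm.monotoneOn univ).eVariationOn_eq (mem_univ _) (mem_univ _)]
    exact ENNReal.ofReal_le_one.2 (by linarith [h0 p.1, h1 p.2])
  have hs : ⨆ x, ‖h x‖ₑ ≤ 1 := by
    refine iSup_le fun x => ?_
    rw [Real.enorm_of_nonneg (h0 x)]
    exact ENNReal.ofReal_le_one.2 (h1 x)
  calc bvNorm h ≤ 1 + 1 := add_le_add hv hs
    _ = 2 := one_add_one_eq_two

/-- The part of `X` in the half-open interval `[i s, (i + 1) s)`. -/
def gridCell (X : Set ℝ) (s : ℝ) (i : ℤ) : Set X := {x | ⌊(x : ℝ) / s⌋ = i}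

theorem measurableSet_gridCell (s : ℝ) (i : ℤ) : MeasurableSet (gridCell X s i) :=
  (Int.measurable_floor.comp (measurable_subtype_coe.div_const s)) (measurableSet_singleton i)

theorem mem_gridCell {s : ℝ} (hs : 0 < s) {i : ℤ} {x : X} :
    x ∈ gridCell X s i ↔ i * s ≤ x ∧ (x : ℝ) < (i + 1) * s := by
  rw [gridCell, mem_ofPred_eq, Int.floor_eq_iff, le_div_iff₀ hs, div_lt_iff₀ hs]

theorem pairwise_disjoint_gridCell (s : ℝ) : Pairwise (Function.onFun Disjoint (gridCell X s)) := by
  intro i j hij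
  refine disjoint_left.2 fun x hi hj => hij ?_
  exact (hi : ⌊(x : ℝ) / s⌋ = i).symm.trans hj

theorem dist_lt_of_mem_gridCell {s : ℝ} (hs : 0 < s) {i : ℤ} {x y : X}
    (hx : x ∈ gridCell X s i) (hy : y ∈ gridCell X s i) : dist x y < s := by
  rw [mem_gridCell hs] at hx hy
  rw [Subtype.dist_eq, Real.dist_eq, abs_lt]
  constructor <;> nlinarith

/-- Decay of correlations for the indicator function of an upper ray. -/
theorem HasDecayBVL1.abs_ray_le {f : X → X} {μ : Measure X} [IsProbabilityMeasure μ]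
    {Θ : ℕ → ℝ} (h : HasDecayBVL1 f μ Θ) (hf : Measurable f) (hΘ : ∀ j, 0 ≤ Θ j) (a : ℝ)
    {D : Set X} (hD : MeasurableSet D) (j : ℕ) :
    |μ.real ({x : X | a ≤ x} ∩ f^[j] ⁻¹' D) - μ.real {x : X | a ≤ x} * μ.real D|
      ≤ 2 * Θ j * μ.real D := by
  set R := {x : X | a ≤ x} with hR
  have hRm : MeasurableSet R := measurableSet_le measurable_const measurable_subtype_coe
  have hb : bvNorm (R.indicator (1 : X → ℝ)) ≤ 2 := by
    refine bvNorm_le_two_of_monotone ?_ (fun x => indicator_nonneg (by simp) x)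
      (fun x => indicator_le_self' (f := (1 : X → ℝ)) (by simp) x)
    intro x y hxy
    by_cases hx : x ∈ R
    · have hy : y ∈ R := le_trans (show a ≤ x from hx) hxy
      simp [hx, hy]
    · simp only [indicator_of_notMem hx]
      exact indicator_nonneg (by simp) y
  have key := h.2 (R.indicator 1) (D.indicator 1) (hb.trans_lt (by simp))
    ((integrable_const (1 : ℝ)).indicator hD) j
  have e1 : ∀ x, R.indicator (1 : X → ℝ) x * D.indicator (1 : X → ℝ) (f^[j] x)
      = (R ∩ f^[j] ⁻¹' D).indicator 1 x := by
    intro x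
    by_cases hx : x ∈ R <;> by_cases hx' : f^[j] x ∈ D <;> simp [hx, hx']
  have e2 : ∀ x, |D.indicator (1 : X → ℝ) x| = D.indicator 1 x := fun x =>
    abs_of_nonneg (indicator_nonneg (by simp) x)
  simp only [e1, e2] at key
  rw [integral_indicator_one (hRm.inter ((hf.iterate j) hD)), integral_indicator_one hRm,
    integral_indicator_one hD] at key
  refine key.trans (mul_le_mul_of_nonneg_right ?_ measureReal_nonneg)
  rw [mul_comm 2]
  exact mul_le_mul_of_nonneg_left (ENNReal.toReal_le_of_le_ofReal (by norm_num) (by simpa using hb))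
    (hΘ j)

/-- Decay of correlations for the indicator function of a grid cell. -/
theorem HasDecayBVL1.abs_gridCell_le {f : X → X} {μ : Measure X} [IsProbabilityMeasure μ]
    {Θ : ℕ → ℝ} (h : HasDecayBVL1 f μ Θ) (hf : Measurable f) (hΘ : ∀ j, 0 ≤ Θ j) {s : ℝ}
    (hs : 0 < s) (i : ℤ) {D : Set X} (hD : MeasurableSet D) (j : ℕ) :
    |μ.real (gridCell X s i ∩ f^[j] ⁻¹' D) - μ.real (gridCell X s i) * μ.real D|
      ≤ 4 * Θ j * μ.real D := by
  set R : ℝ → Set X := fun a => {x : X | a ≤ x} with hR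
  have hRm : ∀ a, MeasurableSet (R a) := fun a =>
    measurableSet_le measurable_const measurable_subtype_coe
  -- A cell is a difference of two upper rays, whose indicators are monotone; the two errors add, so
  -- 2 becomes 4.
  have hc : gridCell X s i = R (i * s) \ R ((i + 1) * s) := by
    ext x
    rw [mem_gridCell hs]
    simp [hR]
  have hsub : R ((i + 1) * s) ⊆ R (i * s) := fun x hx =>
    le_trans (by nlinarith) (show (i + 1) * s ≤ (x : ℝ) from hx)
  have h1 : μ.real (gridCell X s i) = μ.real (R (i * s)) - μ.real (R ((i + 1) * s)) := by
    rw [hc, measureReal_sdiff hsub (hRm _)]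
  have h2 : μ.real (gridCell X s i ∩ f^[j] ⁻¹' D)
      = μ.real (R (i * s) ∩ f^[j] ⁻¹' D) - μ.real (R ((i + 1) * s) ∩ f^[j] ⁻¹' D) := by
    rw [hc, ← measureReal_sdiff (inter_subset_inter_left _ hsub)
      ((hRm _).inter ((hf.iterate j) hD))]
    congr 1
    ext x
    simp only [mem_inter_iff, Set.mem_sdiff]
    tauto
  have k1 := abs_le.1 (h.abs_ray_le hf hΘ (i * s) hD j)
  have k2 := abs_le.1 (h.abs_ray_le hf hΘ ((i + 1) * s) hD j)
  rw [h1, h2, abs_le]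
  simp only [hR] at k1 k2 ⊢
  constructor <;> linarith

theorem lebesgueOn_real_apply (hX : MeasurableSet X) (A : Set X) :
    (lebesgueOn X).real A = volume.real (Subtype.val '' A) := by
  rw [lebesgueOn, measureReal_def, comap_subtype_coe_apply hX, measureReal_def]

theorem isFiniteMeasure_lebesgueOn (hX : MeasurableSet X) (hXb : Bornology.IsBounded X) :
    IsFiniteMeasure (lebesgueOn X) := by
  refine ⟨?_⟩
  rw [lebesgueOn, comap_subtype_coe_apply hX, image_univ, Subtype.range_coe]
  exact hXb.measure_lt_top

theorem IsBV.measurable [X.OrdConnected] {φ : X → ℝ} (h : IsBV φ) : Measurable φ := by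
  have hv : BoundedVariationOn φ univ := (lt_of_le_of_lt le_self_add h).ne
  obtain ⟨p, q, hp, hq, rfl⟩ := hv.locallyBoundedVariationOn.exists_monotoneOn_sub_monotoneOn
  exact (monotoneOn_univ.1 hp).measurable.sub (monotoneOn_univ.1 hq).measurable

theorem IsBV.exists_bound {φ : X → ℝ} (h : IsBV φ) : ∃ M, 0 < M ∧ ∀ x, φ x ≤ M := by
  have hs : ⨆ x, ‖φ x‖ₑ < ∞ := lt_of_le_of_lt le_add_self h
  refine ⟨(⨆ x, ‖φ x‖ₑ).toReal + 1, by positivity, fun x => ?_⟩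
  have := ENNReal.toReal_mono hs.ne (le_iSup (fun x => ‖φ x‖ₑ) x)
  rw [toReal_enorm, Real.norm_eq_abs] at this
  linarith [le_abs_self (φ x)]

variable {ρ : X → ℝ} {μ : Measure X} {M : ℝ}

theorem measureReal_eq_setIntegral_density [IsFiniteMeasure (lebesgueOn X)]
    (hρm : Measurable ρ) (hρ0 : ∀ x, 0 ≤ ρ x)
    (hμ : μ = (lebesgueOn X).withDensity (fun x => ENNReal.ofReal (ρ x)))
    {A : Set X} (hA : MeasurableSet A) : μ.real A = ∫ x in A, ρ x ∂lebesgueOn X := by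
  rw [integral_eq_lintegral_of_nonneg_ae (Eventually.of_forall hρ0)
    hρm.aestronglyMeasurable, measureReal_def, hμ, withDensity_apply _ hA]

theorem integrable_of_nonneg_of_le [IsFiniteMeasure (lebesgueOn X)]
    (hρm : Measurable ρ) (hρ0 : ∀ x, 0 ≤ ρ x) (hM : ∀ x, ρ x ≤ M) :
    Integrable ρ (lebesgueOn X) :=
  Integrable.of_bound hρm.aestronglyMeasurable M
    (Eventually.of_forall fun x => by rw [Real.norm_of_nonneg (hρ0 x)]; exact hM x)

theorem measureReal_le_mul_lebesgueOn [IsFiniteMeasure (lebesgueOn X)]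
    (hρm : Measurable ρ) (hρ0 : ∀ x, 0 ≤ ρ x) (hM : ∀ x, ρ x ≤ M)
    (hμ : μ = (lebesgueOn X).withDensity (fun x => ENNReal.ofReal (ρ x)))
    {A : Set X} (hA : MeasurableSet A) : μ.real A ≤ M * (lebesgueOn X).real A := by
  rw [measureReal_eq_setIntegral_density hρm hρ0 hμ hA]
  calc ∫ x in A, ρ x ∂lebesgueOn X ≤ ∫ _ in A, M ∂lebesgueOn X :=
        integral_mono (integrable_of_nonneg_of_le hρm hρ0 hM).integrableOn
          (integrable_const M) hM
    _ = M * (lebesgueOn X).real A := by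
        rw [setIntegral_const, smul_eq_mul, mul_comm]

theorem lebesgueOn_gridCell_le (hX : MeasurableSet X) {s : ℝ} (hs : 0 < s) (i : ℤ) :
    (lebesgueOn X).real (gridCell X s i) ≤ s := by
  rw [lebesgueOn_real_apply hX]
  have : Subtype.val '' gridCell X s i ⊆ Ico (i * s) ((i + 1) * s) := by
    rintro _ ⟨x, hx, rfl⟩
    exact (mem_gridCell hs).1 hx
  calc _ ≤ volume.real (Ico (i * s) ((i + 1) * s)) := measureReal_mono this measure_Ico_lt_top.ne
    _ = s := by
      rw [Real.volume_real_Ico_of_le (by nlinarith)]; ring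

/-- The points of `X` at distance at most `s` from the finite set `P`. -/
def nearSet (X : Set ℝ) (P : Finset ℝ) (s : ℝ) : Set X := {x | ∃ p ∈ P, |(x : ℝ) - p| ≤ s}

theorem measurableSet_nearSet (P : Finset ℝ) (s : ℝ) : MeasurableSet (nearSet X P s) := by
  have : nearSet X P s = ⋃ p ∈ P, {x : X | |(x : ℝ) - p| ≤ s} := by
    ext x; simp [nearSet]
  rw [this]
  exact P.measurableSet_biUnion fun p _ => measurableSet_le
    ((measurable_subtype_coe.sub_const p).abs) measurable_const

theorem lebesgueOn_nearSet_le (hX : MeasurableSet X) (P : Finset ℝ) {s : ℝ} (hs : 0 ≤ s) :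
    (lebesgueOn X).real (nearSet X P s) ≤ P.card * (2 * s) := by
  rw [lebesgueOn_real_apply hX]
  have hsub : Subtype.val '' nearSet X P s ⊆ ⋃ p ∈ P, Icc (p - s) (p + s) := by
    rintro _ ⟨x, ⟨p, hp, hx⟩, rfl⟩
    refine mem_biUnion hp ?_
    rw [abs_le] at hx
    constructor <;> linarith
  calc _ ≤ volume.real (⋃ p ∈ P, Icc (p - s) (p + s)) :=
        measureReal_mono hsub ((measure_biUnion_lt_top P.finite_toSet
          fun _ _ => measure_Icc_lt_top).ne)
    _ ≤ ∑ p ∈ P, volume.real (Icc (p - s) (p + s)) := measureReal_biUnion_finset_le _ _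
    _ = P.card * (2 * s) := by
        rw [Finset.sum_congr rfl fun p _ => show volume.real (Icc (p - s) (p + s)) = 2 * s by
          rw [Real.volume_real_Icc_of_le (by linarith)]; ring]
        simp

/-- A cell with a point far from the end points of `X` is a full interval. -/
theorem lebesgueOn_gridCell_eq (hX : X.OrdConnected) (hXb : Bornology.IsBounded X) {P : Finset ℝ}
    (hinf : sInf X ∈ P) (hsup : sSup X ∈ P) {s : ℝ} (hs : 0 < s) {i : ℤ} {x₀ : X}
    (hx₀ : x₀ ∈ gridCell X s i) (hfar : x₀ ∉ nearSet X P s) :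
    (lebesgueOn X).real (gridCell X s i) = s := by
  have hfar' : ∀ p ∈ P, s < |(x₀ : ℝ) - p| := fun p hp => by
    by_contra hcon
    exact hfar ⟨p, hp, not_lt.1 hcon⟩
  have h1 : sInf X ≤ x₀ := csInf_le hXb.bddBelow x₀.2
  have h2 : (x₀ : ℝ) ≤ sSup X := le_csSup hXb.bddAbove x₀.2
  have h3 := hfar' _ hinf
  have h4 := hfar' _ hsup
  rw [abs_of_nonneg (by linarith)] at h3
  rw [abs_of_nonpos (by linarith)] at h4
  have hx₀' := (mem_gridCell hs).1 hx₀
  have himg : Subtype.val '' gridCell X s i = Ico (i * s) ((i + 1) * s) := by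
    ext y
    constructor
    · rintro ⟨x, hx, rfl⟩
      exact (mem_gridCell hs).1 hx
    · intro hy
      have hne : X.Nonempty := ⟨x₀, x₀.2⟩
      obtain ⟨a, ha, hay⟩ := exists_lt_of_csInf_lt hne (show sInf X < y by nlinarith [hy.1])
      obtain ⟨b, hb, hyb⟩ := exists_lt_of_lt_csSup hne (show y < sSup X by nlinarith [hy.2])
      exact ⟨⟨y, hX.out ha hb ⟨hay.le, hyb.le⟩⟩, (mem_gridCell hs).2 hy, rfl⟩
  rw [lebesgueOn_real_apply hX.measurableSet, himg, Real.volume_real_Ico_of_le (by nlinarith)]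
  ring

/-- A discontinuity between two points of the cell would itself lie in the cell, hence within `s` of
`x₀`. -/
theorem disjoint_uIcc_of_gridCell {P : Finset ℝ} {C : Set X} (hC : ∀ x ∈ C, (x : ℝ) ∈ P)
    {s : ℝ} (hs : 0 < s) {i : ℤ} {x₀ x y : X} (hx₀ : x₀ ∈ gridCell X s i)
    (hfar : x₀ ∉ nearSet X P s) (hx : x ∈ gridCell X s i) (hy : y ∈ gridCell X s i) :
    Disjoint (uIcc x y) C := by
  refine disjoint_left.2 fun z hz hzC => hfar ⟨z, hC z hzC, ?_⟩
  have hzc : z ∈ gridCell X s i := by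
    rw [mem_gridCell hs] at hx hy ⊢
    rcases mem_uIcc.1 hz with ⟨h1, h2⟩ | ⟨h1, h2⟩
    · exact ⟨hx.1.trans h1, lt_of_le_of_lt h2 hy.2⟩
    · exact ⟨hy.1.trans h1, lt_of_le_of_lt h2 hx.2⟩
  exact (dist_lt_of_mem_gridCell hs hx₀ hzc).le

end Line

/-! ### Non-return estimate at a fixed scale -/

section Scale

variable {X : Set ℝ}

/-- The points that do not return closer than `s` to themselves up to time `N`. -/
def noReturnSet (f : X → X) (N : ℕ) (s : ℝ) : Set X :=
  {x | ∀ j ∈ Finset.Icc 1 N, s ≤ dist (f^[j] x) x}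

/-- Two points of a cell are less than `s` apart. Times `0, …, N - 1` along the orbit of `f x` are
times `1, …, N` along that of `x`. -/
theorem noReturnSet_inter_gridCell_subset (f : X → X) (N : ℕ) {s : ℝ} (hs : 0 < s) (i : ℤ) :
    noReturnSet f N s ∩ gridCell X s i
      ⊆ gridCell X s i ∩ f ⁻¹' avoidSet f (gridCell X s i) N := by
  rintro x ⟨hx, hxi⟩
  refine ⟨hxi, fun j hj hj' => ?_⟩
  rw [← Function.iterate_succ_apply] at hj'
  exact (hx (j + 1) (Finset.mem_Icc.2 ⟨by omega, hj⟩)).not_gt (dist_lt_of_mem_gridCell hs hj' hxi)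

/-- The short returns to all cells together are controlled by the return sets. -/
theorem sum_gridCell_return_le {f : X → X} {μ : Measure X} [IsProbabilityMeasure μ]
    (hf : Measurable f) {s : ℝ} (hs : 0 < s) (G : Finset ℤ) (g : ℕ) :
    ∑ i ∈ G, ∑ j ∈ Finset.Icc 1 g, μ.real (gridCell X s i ∩ f^[j] ⁻¹' gridCell X s i)
      ≤ ∑ j ∈ Finset.Icc 1 g, μ.real (returnSet f j s) := by
  rw [Finset.sum_comm]
  refine Finset.sum_le_sum fun j _ => ?_
  -- The cells are disjoint, so the sum over `i` is the measure of a single union inside the return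
  -- set.
  rw [← measureReal_biUnion_finset]
  · refine measureReal_mono (iUnion₂_subset fun i _ => ?_)
    rintro x ⟨hx, hx'⟩
    exact (dist_lt_of_mem_gridCell hs hx hx').le
  · intro a _ b _ hab
    exact (pairwise_disjoint_gridCell s hab).mono inter_subset_left inter_subset_left
  · exact fun i _ => (measurableSet_gridCell s i).inter
      ((hf.iterate j) (measurableSet_gridCell s i))

theorem exists_finset_gridCell {R : ℝ} (hR : ∀ x ∈ X, |x| ≤ R) (hR0 : 0 ≤ R) {s : ℝ} (hs : 0 < s) :
    ∃ F : Finset ℤ, (F.card : ℝ) ≤ 2 * R / s + 2 ∧ ∀ x : X, ∃ i ∈ F, x ∈ gridCell X s i := by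
  refine ⟨Finset.Icc ⌊-R / s⌋ ⌊R / s⌋, ?_, fun x => ⟨⌊(x : ℝ) / s⌋, Finset.mem_Icc.2 ⟨?_, ?_⟩, rfl⟩⟩
  · have hle : ⌊-R / s⌋ ≤ ⌊R / s⌋ + 1 := by
      have : ⌊-R / s⌋ ≤ ⌊R / s⌋ := Int.floor_le_floor (by gcongr; linarith)
      omega
    have hcast : (((Finset.Icc ⌊-R / s⌋ ⌊R / s⌋).card : ℤ) : ℝ)
        = ((⌊R / s⌋ + 1 - ⌊-R / s⌋ : ℤ) : ℝ) := by
      rw [Int.card_Icc, Int.toNat_of_nonneg (by omega)]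
    rw [Int.cast_natCast] at hcast
    rw [hcast]
    push_cast
    have h1 := Int.floor_le (R / s)
    have h2 := Int.lt_floor_add_one (-R / s)
    have h3 : -R / s = -(R / s) := neg_div _ _
    have h4 : 2 * R / s = R / s + R / s := by ring
    linarith
  · exact Int.floor_le_floor (by gcongr; exact (abs_le.1 (hR x x.2)).1)
  · exact Int.floor_le_floor (by gcongr; exact (abs_le.1 (hR x x.2)).2)

variable {ρ : X → ℝ} {μ : Measure X} {M : ℝ}

/-- On a full cell on which `ρ` is almost constant, `μ(A) exp(-n μ(A))` is comparable with the
integral of `ρ exp(-n s ρ)`. -/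
theorem measureReal_mul_exp_le [IsFiniteMeasure (lebesgueOn X)]
    (hρm : Measurable ρ) (hρ0 : ∀ x, 0 ≤ ρ x) (hM : ∀ x, ρ x ≤ M)
    (hμ : μ = (lebesgueOn X).withDensity (fun x => ENNReal.ofReal (ρ x)))
    {A : Set X} (hA : MeasurableSet A) {s κ : ℝ} (hs : (lebesgueOn X).real A = s)
    (hosc : ∀ x ∈ A, ∀ y ∈ A, |ρ x - ρ y| ≤ κ) (n : ℕ) (hκ : n * (s * κ) ≤ 1) :
    μ.real A * Real.exp (-(n * μ.real A))
      ≤ 3 * ∫ x in A, ρ x * Real.exp (-(n * s * ρ x)) ∂lebesgueOn X := by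
  have hint := integrable_of_nonneg_of_le hρm hρ0 hM
  have hs0 : 0 ≤ s := hs ▸ measureReal_nonneg
  have hlow : ∀ x ∈ A, s * (ρ x - κ) ≤ μ.real A := by
    intro x hx
    rw [measureReal_eq_setIntegral_density hρm hρ0 hμ hA]
    calc s * (ρ x - κ) = ∫ _ in A, (ρ x - κ) ∂lebesgueOn X := by
          rw [setIntegral_const, hs, smul_eq_mul]
      _ ≤ _ := setIntegral_mono_on (integrable_const _) hint.integrableOn hA fun y hy => by
          linarith [(abs_le.1 (hosc x hx y hy)).2]
  have hexp : ∀ x ∈ A, Real.exp (-(n * μ.real A)) ≤ 3 * Real.exp (-(n * s * ρ x)) := by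
    intro x hx
    have h3 : Real.exp 1 ≤ 3 := Real.exp_one_lt_d9.le.trans (by norm_num)
    calc Real.exp (-(n * μ.real A)) ≤ Real.exp (1 + -(n * s * ρ x)) := by
          apply Real.exp_le_exp.2
          have := mul_le_mul_of_nonneg_left (hlow x hx) n.cast_nonneg
          linarith
      _ ≤ _ := by rw [Real.exp_add]; gcongr
  have hint2 : Integrable (fun x => ρ x * Real.exp (-(n * s * ρ x))) (lebesgueOn X) := by
    refine hint.mono' (by fun_prop) (Eventually.of_forall fun x => ?_)
    have hx := hρ0 x
    rw [Real.norm_of_nonneg (by positivity)]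
    exact mul_le_of_le_one_right hx (Real.exp_le_one_iff.2 (by
      have : 0 ≤ n * s * ρ x := by positivity
      linarith))
  rw [← integral_const_mul]
  calc μ.real A * Real.exp (-(n * μ.real A))
      = ∫ x in A, ρ x * Real.exp (-(n * μ.real A)) ∂lebesgueOn X := by
        rw [integral_mul_const, ← measureReal_eq_setIntegral_density hρm hρ0 hμ hA]
    _ ≤ _ := setIntegral_mono_on (hint.mul_const _).integrableOn (hint2.const_mul 3).integrableOn hA
        fun x hx => by
          have := mul_le_mul_of_nonneg_left (hexp x hx) (hρ0 x)
          linarith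

/-- The measure of the points that do not return closer than `s` up to time `g + n`. -/
theorem measureReal_noReturnSet_le [IsProbabilityMeasure μ] (hX : X.OrdConnected)
    (hXb : Bornology.IsBounded X)
    {R : ℝ} (hR : ∀ x ∈ X, |x| ≤ R) (hR0 : 0 ≤ R)
    {f : X → X} (hf : MeasurePreserving f μ μ)
    (hρm : Measurable ρ) (hρ0 : ∀ x, 0 ≤ ρ x) (hM : ∀ x, ρ x ≤ M) (hM0 : 0 ≤ M)
    (hμ : μ = (lebesgueOn X).withDensity (fun x => ENNReal.ofReal (ρ x)))
    {Θ : ℕ → ℝ} (hdec : HasDecayBVL1 f μ Θ) (hΘ : ∀ j, 0 ≤ Θ j)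
    {P : Finset ℝ} (hinf : sInf X ∈ P) (hsup : sSup X ∈ P)
    (hC : ∀ x ∈ discontinuities ρ, (x : ℝ) ∈ P)
    {η L δ : ℝ} (hη : 0 ≤ η) (hL : 0 ≤ L)
    (hHol : ∀ x y : X, dist x y < δ → Disjoint (uIcc x y) (discontinuities ρ) →
      |ρ x - ρ y| ≤ L * dist x y ^ η)
    {s : ℝ} (hs : 0 < s) (hsδ : s ≤ δ) (g n : ℕ)
    (hne : n * (4 * Θ (g + 1)) ≤ 1) (hnL : n * (s * (L * s ^ η)) ≤ 1) :
    μ.real (noReturnSet f (g + n) s) ≤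
      9 * ∫ x, ρ x * Real.exp (-(n * s * ρ x)) ∂lebesgueOn X
      + 3 * (M * s) * n * ∑ j ∈ Finset.Icc 1 g, μ.real (returnSet f j s)
      + (2 * R / s + 2) * (4 * Θ (g + 1)) + M * (P.card * (2 * s)) := by
  classical
  have hXm : MeasurableSet X := hX.measurableSet
  have := isFiniteMeasure_lebesgueOn hXm hXb
  have hint := integrable_of_nonneg_of_le hρm hρ0 hM
  have he : 0 ≤ 4 * Θ (g + 1) := by linarith [hΘ (g + 1)]
  obtain ⟨F, hFcard, hF⟩ := exists_finset_gridCell hR hR0 hs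
  -- Good cells: a point farther than `s` from `P` makes the whole cell a full interval free of
  -- jumps. All other cells lie in `nearSet X P s`.
  set G := F.filter fun i => ∃ x ∈ gridCell X s i, x ∉ nearSet X P s with hG
  set Q : ℤ → ℝ := fun i =>
    ∑ j ∈ Finset.Icc 1 g, μ.real (gridCell X s i ∩ f^[j] ⁻¹' gridCell X s i) with hQ
  set ψ : X → ℝ := fun x => ρ x * Real.exp (-(n * s * ρ x)) with hψ
  have hψ0 : ∀ x, 0 ≤ ψ x := fun x => mul_nonneg (hρ0 x) (Real.exp_pos _).le
  have hψint : Integrable ψ (lebesgueOn X) := by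
    refine hint.mono' (by fun_prop) (Eventually.of_forall fun x => ?_)
    rw [Real.norm_of_nonneg (hψ0 x)]
    refine mul_le_of_le_one_right (hρ0 x) (Real.exp_le_one_iff.2 ?_)
    have : 0 ≤ n * s * ρ x := mul_nonneg (by positivity) (hρ0 x)
    linarith
  have hcover : noReturnSet f (g + n) s ⊆ (⋃ i ∈ G, gridCell X s i ∩
      f ⁻¹' avoidSet f (gridCell X s i) (g + n)) ∪ nearSet X P s := by
    intro x hx
    by_cases hxP : x ∈ nearSet X P s
    · exact Or.inr hxP
    · obtain ⟨i, hi, hxi⟩ := hF x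
      exact Or.inl (mem_biUnion (Finset.mem_filter.2 ⟨hi, x, hxi, hxP⟩)
        (noReturnSet_inter_gridCell_subset f _ hs i ⟨hx, hxi⟩))
  -- The factor 9 is 3 from the avoidance bound times 3 from replacing `μ(A)` by `s ρ`; each 3
  -- bounds `exp 1`.
  have hcell : ∀ i ∈ G, μ.real (gridCell X s i ∩ f ⁻¹' avoidSet f (gridCell X s i) (g + n))
      ≤ 9 * ∫ x in gridCell X s i, ψ x ∂lebesgueOn X + 3 * (M * s) * n * Q i
        + 4 * Θ (g + 1) := by
    intro i hi
    obtain ⟨x₀, hx₀, hfar⟩ := (Finset.mem_filter.1 hi).2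
    have hA := measurableSet_gridCell (X := X) s i
    have hQ0 : 0 ≤ Q i := Finset.sum_nonneg fun _ _ => measureReal_nonneg
    have h1 := measureReal_inter_preimage_avoidSet_le hf hA he g
      (fun m => hdec.abs_gridCell_le hf.measurable hΘ hs i
        (measurableSet_avoidSet hf.measurable hA m) (g + 1)) n hne
    have h2 := measureReal_mul_exp_le hρm hρ0 hM hμ hA
      (lebesgueOn_gridCell_eq hX hXb hinf hsup hs hx₀ hfar) (κ := L * s ^ η)
      (fun x hx y hy => by
        have hd := dist_lt_of_mem_gridCell hs hx hy
        exact (hHol x y (hd.trans_le hsδ)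
          (disjoint_uIcc_of_gridCell hC hs hx₀ hfar hx hy)).trans (by gcongr)) n hnL
    have h3 : μ.real (gridCell X s i) ≤ M * s :=
      (measureReal_le_mul_lebesgueOn hρm hρ0 hM hμ hA).trans
        (mul_le_mul_of_nonneg_left (lebesgueOn_gridCell_le hXm hs i) hM0)
    have h4 : 3 * μ.real (gridCell X s i) * n * Q i ≤ 3 * (M * s) * n * Q i := by gcongr
    simp only [hQ, hψ] at h4 ⊢
    linarith
  have hsum1 : ∑ i ∈ G, ∫ x in gridCell X s i, ψ x ∂lebesgueOn X ≤ ∫ x, ψ x ∂lebesgueOn X := by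
    rw [← integral_biUnion_finset G (fun i _ => measurableSet_gridCell s i)
      (fun i _ j _ hij => pairwise_disjoint_gridCell s hij) (fun i _ => hψint.integrableOn)]
    exact setIntegral_le_integral hψint (Eventually.of_forall hψ0)
  have hsum2 := sum_gridCell_return_le (μ := μ) hf.measurable hs G g
  have hGcard : (G.card : ℝ) ≤ 2 * R / s + 2 :=
    le_trans (by exact_mod_cast Finset.card_filter_le _ _) hFcard
  have hnear : μ.real (nearSet X P s) ≤ M * (P.card * (2 * s)) :=
    (measureReal_le_mul_lebesgueOn hρm hρ0 hM hμ (measurableSet_nearSet P s)).trans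
      (mul_le_mul_of_nonneg_left (lebesgueOn_nearSet_le hXm P hs.le) hM0)
  calc μ.real (noReturnSet f (g + n) s)
      ≤ ∑ i ∈ G, μ.real (gridCell X s i ∩ f ⁻¹' avoidSet f (gridCell X s i) (g + n))
        + μ.real (nearSet X P s) :=
      (measureReal_mono hcover).trans <| (measureReal_union_le _ _).trans <|
        add_le_add_left (measureReal_biUnion_finset_le _ _) _
    _ ≤ ∑ i ∈ G, (9 * ∫ x in gridCell X s i, ψ x ∂lebesgueOn X + 3 * (M * s) * n * Q i
        + 4 * Θ (g + 1)) + M * (P.card * (2 * s)) :=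
      add_le_add (Finset.sum_le_sum hcell) hnear
    _ = 9 * ∑ i ∈ G, ∫ x in gridCell X s i, ψ x ∂lebesgueOn X
        + 3 * (M * s) * n * ∑ i ∈ G, Q i + G.card * (4 * Θ (g + 1))
        + M * (P.card * (2 * s)) := by
      rw [Finset.sum_add_distrib, Finset.sum_add_distrib, ← Finset.mul_sum, ← Finset.mul_sum,
        Finset.sum_const, nsmul_eq_mul]
    _ ≤ _ := by gcongr

end Scale

/-! ### Powers, geometric decay and dyadic comparison -/

section Asymptotics

theorem summable_rpow_mul_pow (p : ℝ) {q : ℝ} (hq0 : 0 ≤ q) (hq1 : q < 1) :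
    Summable fun k : ℕ => (k : ℝ) ^ p * q ^ k := by
  refine Summable.of_norm_bounded_eventually_nat
    (summable_pow_mul_geometric_of_norm_lt_one ⌈p⌉₊ (r := q) (by
      rwa [Real.norm_of_nonneg hq0])) ?_
  filter_upwards [eventually_ge_atTop 1] with k hk
  have hk' : (1 : ℝ) ≤ k := by exact_mod_cast hk
  rw [Real.norm_of_nonneg (by positivity)]
  gcongr
  rw [← Real.rpow_natCast]
  exact Real.rpow_le_rpow_of_exponent_le hk' (Nat.le_ceil p)

theorem eventually_mul_rpow_mul_pow_le (a p : ℝ) {q : ℝ} (hq0 : 0 ≤ q) (hq1 : q < 1) {b : ℝ}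
    (hb : 0 < b) : ∀ᶠ k : ℕ in atTop, a * ((k : ℝ) ^ p * q ^ k) ≤ b := by
  have h := (summable_rpow_mul_pow p hq0 hq1).tendsto_atTop_zero.const_mul a
  rw [mul_zero] at h
  exact h.eventually_le_const hb

theorem eventually_rpow_le_mul_rpow {γ₀ γ c : ℝ} (hγ : γ₀ < γ) (hc : 0 < c) :
    ∀ᶠ k : ℕ in atTop, (k : ℝ) ^ γ₀ ≤ c * (k : ℝ) ^ γ := by
  have h := ((tendsto_rpow_atTop (sub_pos.2 hγ)).comp
    tendsto_natCast_atTop_atTop).eventually_ge_atTop (1 / c)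
  filter_upwards [h, eventually_ge_atTop 1] with k hk hk1
  have hk0 : (0 : ℝ) < k := by exact_mod_cast hk1
  have e : (k : ℝ) ^ γ = (k : ℝ) ^ γ₀ * (k : ℝ) ^ (γ - γ₀) := by
    rw [← Real.rpow_add hk0]; congr 1; ring
  rw [Function.comp_apply, div_le_iff₀ hc] at hk
  rw [e]
  have := mul_le_mul_of_nonneg_left hk (Real.rpow_nonneg hk0.le γ₀)
  linarith

theorem rpow_neg_abs_mul_le {x y : ℝ} (hx : 0 < x) (h1 : x / 2 ≤ y) (h2 : y ≤ 2 * x) (γ : ℝ) :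
    2 ^ (-|γ|) * x ^ γ ≤ y ^ γ := by
  have hy : 0 < y := by linarith
  rcases le_total 0 γ with h | h
  · rw [abs_of_nonneg h, Real.rpow_neg (by norm_num), ← Real.inv_rpow (by norm_num),
      ← Real.mul_rpow (by norm_num) hx.le]
    exact Real.rpow_le_rpow (by positivity) (by linarith) h
  · rw [abs_of_nonpos h, neg_neg, ← Real.mul_rpow (by norm_num) hx.le]
    exact Real.rpow_le_rpow_of_nonpos hy h2 h

/-- Here `log n` lies between `k / 2` and `2 k`, which costs `2 ^ (-|γ|)` for either sign of `γ`,
and `2 n ≤ 8 * 2 ^ k` gives the 8. -/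
theorem dyadic_scale_le (γ : ℝ) {k n : ℕ} (hk : 2 ≤ k) (h1 : 2 ^ (k + 1) ≤ n)
    (h2 : n < 2 ^ (k + 2)) :
    2 ^ (-|γ|) / 8 * (k : ℝ) ^ γ * (1 / 2) ^ k ≤ Real.log n ^ γ / (2 * n) := by
  have hk' : (2 : ℝ) ≤ k := by exact_mod_cast hk
  have h1' : (2 : ℝ) ^ (k + 1) ≤ n := by exact_mod_cast h1
  have h2' : (n : ℝ) ≤ 2 ^ (k + 2) := by exact_mod_cast h2.le
  have hn : (0 : ℝ) < n := lt_of_lt_of_le (by positivity) h1'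
  have l1 := Real.log_le_log (by positivity) h1'
  have l2 := Real.log_le_log hn h2'
  rw [Real.log_pow] at l1 l2
  push_cast at l1 l2
  have g1 := Real.log_two_gt_d9
  have g2 := Real.log_two_lt_d9
  have key := rpow_neg_abs_mul_le (x := k) (y := Real.log n) (by linarith)
    (by nlinarith) (by nlinarith) γ
  rw [le_div_iff₀ (by positivity)]
  have e : ((1 : ℝ) / 2) ^ k * (2 * n) ≤ 8 := by
    rw [one_div, inv_pow, inv_mul_le_iff₀ (by positivity)]
    rw [pow_add] at h2'
    linarith
  calc 2 ^ (-|γ|) / 8 * (k : ℝ) ^ γ * (1 / 2) ^ k * (2 * n)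
      = 2 ^ (-|γ|) * (k : ℝ) ^ γ / 8 * ((1 / 2) ^ k * (2 * n)) := by ring
    _ ≤ 2 ^ (-|γ|) * (k : ℝ) ^ γ / 8 * 8 := by gcongr
    _ ≤ _ := by linarith

end Asymptotics

/-! ### Summability along dyadic times and Borel–Cantelli -/

section Main

variable {X : Set ℝ}

/-- The scale `k^γ 2^(-k)` need not be comparable to a pure power, so (A2) is applied to the larger
scale `n^(-1/2)` with `n = 2 ^ k`; `returnSet_mono` then transfers the bound. -/
theorem HasRareShortReturns.eventually_two_pow {f : X → X} {μ : Measure X}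
    (h : HasRareShortReturns f μ) :
    ∃ q C : ℝ, 0 ≤ q ∧ q < 1 ∧ 0 < C ∧ ∀ᶠ k : ℕ in atTop, ∀ j : ℕ, 1 ≤ j →
      (j : ℝ) ≤ (k * Real.log 2) ^ 2 →
        μ.real (returnSet f j (((1 / 2 : ℝ) ^ (1 / 2 : ℝ)) ^ k)) ≤ C * q ^ k := by
  obtain ⟨β, C, hβ, -, hC, hev⟩ := h (1 / 2) (fun n => (n : ℝ) ^ (-(1 / 2) : ℝ)) (by norm_num)
    ⟨2, by norm_num, by
      filter_upwards [eventually_ge_atTop 1] with n hn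
      have : (0 : ℝ) < n := by exact_mod_cast hn
      rw [div_self (by positivity)]
      constructor <;> norm_num⟩
  refine ⟨((1 / 2 : ℝ) ^ (1 / 2 : ℝ)) ^ β, C, by positivity,
    Real.rpow_lt_one (by positivity) (Real.rpow_lt_one (by norm_num) (by norm_num)
      (by norm_num)) hβ, hC, ?_⟩
  filter_upwards [(tendsto_pow_atTop_atTop_of_one_lt (one_lt_two (α := ℕ))).eventually hev]
    with k hk j hj hjk
  have e : (((2 ^ k : ℕ) : ℝ)) ^ (-(1 / 2) : ℝ) = ((1 / 2 : ℝ) ^ (1 / 2 : ℝ)) ^ k := by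
    push_cast
    rw [Real.rpow_neg (by positivity), ← Real.inv_rpow (by positivity), ← inv_pow, ← one_div,
      Real.rpow_pow_comm (by norm_num)]
  have := hk j hj (by push_cast; rwa [Real.log_pow])
  rwa [e, ← Real.rpow_pow_comm (x := (1 / 2 : ℝ) ^ (1 / 2 : ℝ)) (by positivity)] at this

theorem returnSet_mono (f : X → X) (j : ℕ) : Monotone (returnSet f j) :=
  fun _ _ hrs _ hx => le_trans hx hrs

theorem noReturnSet_anti (f : X → X) (s : ℝ) : Antitone fun N => noReturnSet f N s :=
  fun _ _ hNM _ hx j hj => hx j (Finset.Icc_subset_Icc_right hNM hj)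

/-- Along dyadic times the probabilities of no close return are summable. -/
theorem summable_measureReal_noReturnSet (hX : X.OrdConnected) (hXb : Bornology.IsBounded X)
    {f : X → X} {μ : Measure X} [IsProbabilityMeasure μ] {ρ : X → ℝ}
    (hsys : IsHyperbolicRecurrent f μ ρ) (hρ : IsPiecewiseHolder ρ) {γ γ₀ c : ℝ} (hγ : γ₀ < γ)
    (hc : 0 < c)
    (hsum : Summable fun k : ℕ =>
      ∫ x : X, ρ x * Real.exp (-((k : ℝ) ^ γ₀ * ρ x)) ∂lebesgueOn X) :
    Summable fun k : ℕ => μ.real (noReturnSet f (2 ^ (k + 1)) (c * (k : ℝ) ^ γ * (1 / 2) ^ k)) := by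
  classical
  have := hX
  have hρm := hsys.density_bv.measurable
  have hρ0 := hsys.density_nonneg
  obtain ⟨M, hM0, hM⟩ := hsys.density_bv.exists_bound
  obtain ⟨R, hR0, hR⟩ := hXb.exists_pos_norm_le
  have := isFiniteMeasure_lebesgueOn hX.measurableSet hXb
  have hint := integrable_of_nonneg_of_le hρm hρ0 hM
  obtain ⟨C, α, hC, hα, hdec⟩ := hsys.exp_decay
  obtain ⟨q, C₂, hq0, hq1, hC₂, hrare⟩ := hsys.rare_short_returns.eventually_two_pow
  obtain ⟨hfin, η, L, δ, hη, -, hL, hδ, hHol⟩ := hρ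
  set P : Finset ℝ := hfin.toFinset.image Subtype.val ∪ {sInf X, sSup X} with hP
  -- With gap `K * k` the correlation error is at most `C 4^(-k)`, which beats both the `2 ^ k` time
  -- steps and the roughly `2^k k^(-γ)` cells.
  obtain ⟨K, hK⟩ := exists_nat_ge (2 / α)
  rw [div_le_iff₀ hα] at hK
  set s : ℕ → ℝ := fun k => c * (k : ℝ) ^ γ * (1 / 2) ^ k with hs
  have hΘ : ∀ k : ℕ, C * Real.exp (-α * (K * k + 1 : ℕ)) ≤ C * (1 / 4) ^ k := by
    intro k
    have h2 : Real.exp (-2) ≤ 1 / 4 := by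
      rw [Real.exp_neg, one_div]
      refine inv_anti₀ (by norm_num) ?_
      have := Real.add_one_le_exp (1 : ℝ)
      calc (4 : ℝ) ≤ Real.exp 1 * Real.exp 1 := by nlinarith
        _ = Real.exp 2 := by rw [← Real.exp_add]; norm_num
    have h1 : Real.exp (-α * (K * k + 1 : ℕ)) ≤ Real.exp (-2) ^ k := by
      rw [← Real.exp_nat_mul]
      apply Real.exp_le_exp.2
      push_cast
      have := mul_le_mul_of_nonneg_right hK (k.cast_nonneg (α := ℝ))
      nlinarith
    gcongr
    exact h1.trans (by gcongr)
  have hhalf : (0 : ℝ) ≤ 1 / 2 := by norm_num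
  have hsqrt1 : (1 / 2 : ℝ) ^ (1 / 2 : ℝ) < 1 := Real.rpow_lt_one hhalf (by norm_num) (by norm_num)
  -- The four groups bound the main integral, short returns, decorrelation and the cells near `P`.
  refine Summable.of_norm_bounded_eventually_nat (g := fun k : ℕ =>
    9 * (∫ x : X, ρ x * Real.exp (-((k : ℝ) ^ γ₀ * ρ x)) ∂lebesgueOn X)
    + 3 * M * c * K * C₂ * ((k : ℝ) ^ (γ + 1) * q ^ k)
    + (8 * R * C / c * ((k : ℝ) ^ (-γ) * (1 / 2) ^ k) + 8 * C * (1 / 4) ^ k)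
    + M * P.card * 2 * c * ((k : ℝ) ^ γ * (1 / 2) ^ k)) ?_ ?_
  · exact (((hsum.mul_left _).add ((summable_rpow_mul_pow _ hq0 hq1).mul_left _)).add
      (((summable_rpow_mul_pow _ hhalf (by norm_num)).mul_left _).add
        ((summable_geometric_of_lt_one (by norm_num) (by norm_num)).mul_left _))).add
      ((summable_rpow_mul_pow _ hhalf (by norm_num)).mul_left _)
  have hηq : ((1 / 2 : ℝ) ^ η) < 1 := Real.rpow_lt_one hhalf (by norm_num) hη
  filter_upwards [hrare, eventually_ge_atTop 1, eventually_rpow_le_mul_rpow hγ hc,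
    eventually_mul_rpow_mul_pow_le (4 * C) 0 hhalf (by norm_num) one_pos,
    eventually_mul_rpow_mul_pow_le (c * L * c ^ η) (γ + γ * η) (by positivity) hηq one_pos,
    eventually_mul_rpow_mul_pow_le c γ hhalf (by norm_num) hδ,
    eventually_mul_rpow_mul_pow_le c γ (by positivity) hsqrt1 one_pos,
    eventually_mul_rpow_mul_pow_le K 1 hhalf (by norm_num) one_pos,
    tendsto_natCast_atTop_atTop.eventually_ge_atTop (K / Real.log 2 ^ 2)]
    with k hr hk1 hγk hΘk hηk hδk hsk hKk hKlog
  have hk0 : (0 : ℝ) < k := by exact_mod_cast hk1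
  have hs0 : 0 < s k := by positivity
  have h2k : (0 : ℝ) < 2 ^ k := by positivity
  have hhk : (2 : ℝ) ^ k * (1 / 2) ^ k = 1 := by rw [← mul_pow]; norm_num
  have hqk : (2 : ℝ) ^ k * (1 / 4) ^ k = (1 / 2) ^ k := by rw [← mul_pow]; norm_num
  have hns : ((2 ^ k : ℕ) : ℝ) * s k = c * (k : ℝ) ^ γ := by
    push_cast
    calc (2 : ℝ) ^ k * (c * (k : ℝ) ^ γ * (1 / 2) ^ k)
        = c * (k : ℝ) ^ γ * (2 ^ k * (1 / 2) ^ k) := by ring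
      _ = _ := by rw [hhk, mul_one]
  -- The gap fits: `K * k + 2 ^ k ≤ 2 ^ (k + 1)`.
  have hg : K * k ≤ 2 ^ k := by
    rw [Real.rpow_one] at hKk
    have : (K : ℝ) * k ≤ 2 ^ k := by
      have := mul_le_mul_of_nonneg_left hKk h2k.le
      calc (K : ℝ) * k = 2 ^ k * (1 / 2) ^ k * (K * k) := by rw [hhk, one_mul]
        _ = 2 ^ k * (K * (k * (1 / 2) ^ k)) := by ring
        _ ≤ _ := by linarith
    exact_mod_cast this
  have hscale := measureReal_noReturnSet_le hX hXb (fun x hx => hR x hx) hR0.le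
    hsys.ergodic.toMeasurePreserving hρm hρ0 hM hM0.le hsys.density_eq hdec
    (fun j => by positivity) (P := P) (by simp [hP]) (by simp [hP])
    (fun x hx => by
      rw [hP, Finset.mem_union]
      exact Or.inl (Finset.mem_image.2 ⟨x, hfin.mem_toFinset.2 hx, rfl⟩))
    hη.le hL.le hHol hs0 (by simpa only [hs, mul_assoc] using hδk) (K * k) (2 ^ k)
    (by
      have := mul_le_mul_of_nonneg_left (hΘ k) h2k.le
      rw [Real.rpow_zero, one_mul] at hΘk
      push_cast at this ⊢
      calc _ ≤ 4 * (2 ^ k * (C * (1 / 4) ^ k)) := by linarith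
        _ = 4 * C * (2 ^ k * (1 / 4) ^ k) := by ring
        _ ≤ 1 := by rwa [hqk])
    (by
      calc ((2 ^ k : ℕ) : ℝ) * (s k * (L * s k ^ η)) = (2 ^ k : ℕ) * s k * L * s k ^ η := by ring
        _ = c * L * c ^ η * ((k : ℝ) ^ (γ + γ * η) * ((1 / 2 : ℝ) ^ η) ^ k) := by
          rw [hns, hs, Real.mul_rpow (by positivity) (by positivity),
            Real.mul_rpow hc.le (by positivity), Real.rpow_add hk0, Real.rpow_mul hk0.le,
            Real.rpow_pow_comm hhalf]
          ring
        _ ≤ 1 := hηk)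
  have hret : ∀ j ∈ Finset.Icc 1 (K * k), μ.real (returnSet f j (s k)) ≤ C₂ * q ^ k := by
    intro j hj
    rw [Finset.mem_Icc] at hj
    have hjk : (j : ℝ) ≤ K * k := by exact_mod_cast hj.2
    rw [div_le_iff₀ (by positivity)] at hKlog
    refine (measureReal_mono (returnSet_mono f j ?_)).trans (hr j hj.1 ?_)
    -- Splitting `2^(-k)` into two factors `2^(-k/2)`, one of which absorbs `c k^γ`, gives `s k ≤
    -- 2^(-k/2)`.
    · have e : (1 / 2 : ℝ) ^ k = ((1 / 2 : ℝ) ^ (1 / 2 : ℝ)) ^ k * ((1 / 2 : ℝ) ^ (1 / 2 : ℝ)) ^ k := by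
        rw [← mul_pow, ← Real.rpow_add (by norm_num)]; norm_num
      rw [hs]
      simp only
      rw [e]
      have := mul_le_mul_of_nonneg_right hsk
        (show (0 : ℝ) ≤ ((1 / 2 : ℝ) ^ (1 / 2 : ℝ)) ^ k by positivity)
      linarith
    · have := mul_le_mul_of_nonneg_right hKlog hk0.le
      nlinarith
  have hsumret : ∑ j ∈ Finset.Icc 1 (K * k), μ.real (returnSet f j (s k))
      ≤ K * k * (C₂ * q ^ k) := by
    refine (Finset.sum_le_card_nsmul _ _ _ hret).trans_eq ?_
    simp
  have t1 : ∫ x, ρ x * Real.exp (-((2 ^ k : ℕ) * s k * ρ x)) ∂lebesgueOn X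
      ≤ ∫ x : X, ρ x * Real.exp (-((k : ℝ) ^ γ₀ * ρ x)) ∂lebesgueOn X := by
    rw [hns]
    refine integral_mono_of_nonneg
      (Eventually.of_forall fun x => mul_nonneg (hρ0 x) (Real.exp_pos _).le) ?_
      (Eventually.of_forall fun x => ?_)
    · refine hint.mono' (by fun_prop) (Eventually.of_forall fun x => ?_)
      have hx := hρ0 x
      rw [Real.norm_of_nonneg (by positivity)]
      refine mul_le_of_le_one_right hx (Real.exp_le_one_iff.2 ?_)
      have : 0 ≤ (k : ℝ) ^ γ₀ * ρ x := by positivity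
      linarith
    · exact mul_le_mul_of_nonneg_left (Real.exp_le_exp.2 (neg_le_neg
        (mul_le_mul_of_nonneg_right hγk (hρ0 x)))) (hρ0 x)
  have t2 : 3 * (M * s k) * (2 ^ k : ℕ) * ∑ j ∈ Finset.Icc 1 (K * k), μ.real (returnSet f j (s k))
      ≤ 3 * M * c * K * C₂ * ((k : ℝ) ^ (γ + 1) * q ^ k) := by
    calc 3 * (M * s k) * (2 ^ k : ℕ) * ∑ j ∈ Finset.Icc 1 (K * k), μ.real (returnSet f j (s k))
        ≤ 3 * (M * s k) * (2 ^ k : ℕ) * (K * k * (C₂ * q ^ k)) := by gcongr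
      _ = 3 * M * ((2 ^ k : ℕ) * s k) * (K * k * (C₂ * q ^ k)) := by ring
      _ = _ := by rw [hns, Real.rpow_add_one hk0.ne']; ring
  have t3 : (2 * R / s k + 2) * (4 * (C * Real.exp (-α * (K * k + 1 : ℕ))))
      ≤ 8 * R * C / c * ((k : ℝ) ^ (-γ) * (1 / 2) ^ k) + 8 * C * (1 / 4) ^ k := by
    have e : 1 / s k * (1 / 4) ^ k = 1 / c * ((k : ℝ) ^ (-γ) * (1 / 2) ^ k) := by
      rw [hs, Real.rpow_neg hk0.le, ← hqk]
      field_simp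
      rw [← mul_pow]; norm_num
    calc (2 * R / s k + 2) * (4 * (C * Real.exp (-α * (K * k + 1 : ℕ))))
        ≤ (2 * R / s k + 2) * (4 * (C * (1 / 4) ^ k)) := by gcongr; exact le_of_mul_le_mul_left (hΘ k) hC
      _ = 8 * R * C * (1 / s k * (1 / 4) ^ k) + 8 * C * (1 / 4) ^ k := by ring
      _ = _ := by rw [e]; ring
  have t4 : M * (P.card * (2 * s k)) = M * P.card * 2 * c * ((k : ℝ) ^ γ * (1 / 2) ^ k) := by
    simp only [hs]; ring
  rw [Real.norm_of_nonneg measureReal_nonneg]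
  have hmono : μ.real (noReturnSet f (2 ^ (k + 1)) (s k))
      ≤ μ.real (noReturnSet f (K * k + 2 ^ k) (s k)) :=
    measureReal_mono (noReturnSet_anti f (s k) (by rw [pow_succ]; omega))
  linarith

end Main

theorem mainTheorem7 (X : Set ℝ) (hX : X.OrdConnected) (hXb : Bornology.IsBounded X)
    (f : X → X) (μ : Measure X) [IsProbabilityMeasure μ] (ρ : X → ℝ)
    (hsys : IsHyperbolicRecurrent f μ ρ)
    (hρ : IsPiecewiseHolder ρ)
    (γ γ₀ : ℝ) (hγ : γ₀ < γ)
    (hsum : ∀ ε : ℝ, 0 < ε →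
      Summable (fun k : ℕ =>
        ∫ x : X, ρ x * Real.exp (-(ε * ((k + 1 : ℕ) : ℝ) ^ γ₀ * ρ x)) ∂lebesgueOn X))
    (r : ℕ → ℝ) (hr : ∀ᶠ n : ℕ in atTop, Real.log n ^ γ / (2 * n) < r n) :
    μ {x : X | ∀ᶠ n : ℕ in atTop, minReturnDist f n x < r n} = 1 := by
  have hsum1 := hsum 1 one_pos
  simp only [one_mul] at hsum1
  have hS := summable_measureReal_noReturnSet hX hXb hsys hρ hγ
    (c := 2 ^ (-|γ|) / 8) (by positivity)
    ((summable_nat_add_iff (f := fun k : ℕ =>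
      ∫ x : X, ρ x * Real.exp (-((k : ℝ) ^ γ₀ * ρ x)) ∂lebesgueOn X) 1).1 hsum1)
  set B : ℕ → Set X := fun k =>
    noReturnSet f (2 ^ (k + 1)) (2 ^ (-|γ|) / 8 * (k : ℝ) ^ γ * (1 / 2) ^ k) with hB
  have hBC : ∑' k, μ (B k) ≠ ∞ := by
    have : ∀ k, μ (B k) = ENNReal.ofReal (μ.real (B k)) := fun k => (ofReal_measureReal).symm
    simp only [this]
    rw [← ENNReal.ofReal_tsum_of_nonneg (fun _ => measureReal_nonneg) hS]
    exact ENNReal.ofReal_ne_top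
  have hae : ∀ᵐ x ∂μ, ∀ᶠ n : ℕ in atTop, minReturnDist f n x < r n := by
    filter_upwards [ae_eventually_notMem hBC] with x hx
    obtain ⟨k₀, hk₀⟩ := eventually_atTop.1 hx
    -- With `2 ^ (k + 1) ≤ n < 2 ^ (k + 2)`, this threshold forces `k ≥ k₀` and the `k ≥ 2` required
    -- by `dyadic_scale_le`.
    filter_upwards [hr, eventually_ge_atTop (2 ^ (max k₀ 2 + 1))] with n hn hn0
    have hn1 : n ≠ 0 := (lt_of_lt_of_le (by positivity) hn0).ne'
    have hlog : max k₀ 2 + 1 ≤ Nat.log 2 n := (Nat.le_log_iff_pow_le one_lt_two hn1).2 hn0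
    obtain ⟨k, hk⟩ : ∃ k, Nat.log 2 n = k + 1 := ⟨Nat.log 2 n - 1, by omega⟩
    have hlow : 2 ^ (k + 1) ≤ n := hk ▸ Nat.pow_log_le_self 2 hn1
    have hupp : n < 2 ^ (k + 2) := by
      have := Nat.lt_pow_succ_log_self one_lt_two n
      rwa [hk] at this
    have hmem := hk₀ k (by omega)
    simp only [hB, noReturnSet, mem_ofPred_eq, not_forall, not_le] at hmem
    obtain ⟨j, hj, hjd⟩ := hmem
    rw [Finset.mem_Icc] at hj
    have hmin : minReturnDist f n x ≤ dist (f^[j] x) x :=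
      csInf_le ⟨0, by rintro _ ⟨i, -, rfl⟩; exact dist_nonneg⟩ ⟨j, ⟨hj.1, hj.2.trans hlow⟩, rfl⟩
    exact ((hmin.trans_lt hjd).trans_le (dyadic_scale_le γ (by omega) hlow hupp)).trans hn
  rw [measure_congr (eventuallyEq_univ.2 hae), measure_univ]
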